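/- Let $(w_k)_{k\in\mathbb Z}$ be a complex white-noise process on a probability space: each $w_k$ is square integrable with $\mathbb E\,w_k=0$, $\mathbb E\,|w_k|^2=1$, and $\mathbb E\,w_k\overline{w_\ell}=0$ for $k\ne\ell$. Let $g=(g_\ell)_{\ell\ge0}$ and $h=(h_\ell)_{\ell\ge0}$ be square-summable complex sequences, identified with the functions $g(z)=\sum_{\ell\ge0}g_\ell z^\ell$ and $h(z)=\sum_{\ell\ge0}h_\ell z^\ell$ of the Hardy space $H_2$, and let $$x_k=\sum_{\ell=0}^\infty g_\ell w_{k-\ell},\qquad y_k=\sum_{\ell=0}^\infty h_\ell w_{k-\ell}\qquad(k\in\mathbb Z),$$ the series converging in mean square. Let $U^*:(a_0,a_1,a_2,\dots)\mapsto(a_1,a_2,a_3,\dots)$ be the backward shift on $\ell^2\cong H_2$; a vector $f$ is called cyclic if the closed linear span of $\{U^{*n}f:n\ge0\}$ is the whole space. Suppose that $g$ is cyclic and that $h\neq0$ is not cyclic. Then the process $(x_k,y_k)$ is deterministic in the backward time direction: for every $k\in\mathbb Z$ (in particular for $k=0$) and every $\varepsilon>0$ there are finite linear combinations $\hat x=\sum_{\ell=1}^n(a_\ell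 x_{k+\ell}+b_\ell y_{k+\ell})$ and $\hat y=\sum_{\ell=1}^m(a'_\ell x_{k+\ell}+b'_\ell y_{k+\ell})$ of future values, with complex coefficients, such that $\big(\mathbb E|x_k-\hat x|^2\big)^{1/2}<\varepsilon$ and $\big(\mathbb E|y_k-\hat y|^2\big)^{1/2}<\varepsilon$. -/

import Mathlib

open MeasureTheory Filter Topology
open scoped ENNReal ComplexConjugate

/-- The sequence space of square summable complex sequences `(a₀, a₁, a₂, …)`, identified with the
Hardy space `H₂` of the disc through `f(z) = ∑ aₗ zˡ`. -/
abbrev HardyTwo : Type := lp (fun _ : ℕ => ℂ) 2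

theorem memℓp_two_tail (f : HardyTwo) : Memℓp (fun n : ℕ => f (n + 1)) 2 := by
  have hf := (memℓp_gen_iff (p := 2) (by norm_num)).1 (lp.memℓp f)
  exact memℓp_gen ((summable_nat_add_iff 1).2 hf)

/-- The backward shift as a linear map: `(a₀, a₁, a₂, …) ↦ (a₁, a₂, a₃, …)`. -/
def backwardShiftLinear : HardyTwo →ₗ[ℂ] HardyTwo where
  toFun f := ⟨fun n => f (n + 1), memℓp_two_tail f⟩
  map_add' _ _ := rfl
  map_smul' _ _ := rfl

theorem norm_backwardShiftLinear_le (f : HardyTwo) :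
    ‖backwardShiftLinear f‖ ≤ 1 * ‖f‖ := by
  have h2 : (0 : ℝ) < (2 : ℝ≥0∞).toReal := by norm_num
  rw [one_mul]
  refine lp.norm_le_of_tsum_le h2 (norm_nonneg _) ?_
  have hf := (memℓp_gen_iff (p := 2) h2).1 (lp.memℓp f)
  rw [lp.norm_rpow_eq_tsum h2 f, hf.tsum_eq_zero_add]
  exact le_add_of_nonneg_left (by positivity)

/-- The backward shift `U*` on `H₂ ≅ ℓ²`, `(a₀, a₁, a₂, …) ↦ (a₁, a₂, a₃, …)`, that is
`f ↦ (f - f(0)) / z`, as a bounded operator. -/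
noncomputable def backwardShift : HardyTwo →L[ℂ] HardyTwo :=
  backwardShiftLinear.mkContinuous 1 norm_backwardShiftLinear_le

/-- `f` is a cyclic vector of `A`: the closed span of `{Aⁿ f : n ≥ 0}` is the whole space. -/
def IsCyclicVector {E : Type*} [NormedAddCommGroup E] [NormedSpace ℂ E] (A : E →L[ℂ] E) (f : E) :
    Prop :=
  (Submodule.span ℂ (Set.range fun n : ℕ => (A ^ n) f)).topologicalClosure = ⊤

/-- Complex white noise: square integrable, zero mean, unit variance, pairwise uncorrelated. -/
structure IsWhiteNoise {Ω : Type*} [MeasurableSpace Ω] (μ : Measure Ω) (w : ℤ → Ω → ℂ) : Prop where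
  memLp : ∀ k, MemLp (w k) 2 μ
  mean_zero : ∀ k, ∫ ω, w k ω ∂μ = 0
  covariance : ∀ k l, ∫ ω, w k ω * conj (w l ω) ∂μ = if k = l then 1 else 0

/-- `x k = ∑_{ℓ ≥ 0} c ℓ * w (k - ℓ)` for every `k`, the series converging in mean square. -/
def IsCausalFilterOutput {Ω : Type*} [MeasurableSpace Ω] (μ : Measure Ω) (w : ℤ → Ω → ℂ)
    (c : ℕ → ℂ) (x : ℤ → Ω → ℂ) : Prop :=
  ∀ k : ℤ, MemLp (x k) 2 μ ∧
    Tendsto (fun n : ℕ =>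
        eLpNorm (fun ω => x k ω - ∑ l ∈ Finset.range n, c l * w (k - (l : ℤ)) ω) 2 μ)
      atTop (𝓝 0)

/-- The random variable `v` can be estimated with arbitrarily small root mean square error by
finite linear combinations of the values of `(x, y)` at times strictly later than `k`. -/
def IsEstimableFromFuture {Ω : Type*} [MeasurableSpace Ω] (μ : Measure Ω) (x y : ℤ → Ω → ℂ)
    (k : ℤ) (v : Ω → ℂ) : Prop :=
  ∀ ε : ℝ, 0 < ε → ∃ (n : ℕ) (a b : ℕ → ℂ),
    eLpNorm (fun ω => v ω - ∑ l ∈ Finset.Icc 1 n,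
      (a l * x (k + (l : ℤ)) ω + b l * y (k + (l : ℤ)) ω)) 2 μ < ENNReal.ofReal ε

/-- The bivariate process `(x, y)` is deterministic in the backward time direction: at each time
both components are determined, in the sense of linear mean square estimation, by the future. -/
def IsBackwardDeterministic {Ω : Type*} [MeasurableSpace Ω] (μ : Measure Ω) (x y : ℤ → Ω → ℂ) :
    Prop :=
  ∀ k : ℤ, IsEstimableFromFuture μ x y k (x k) ∧ IsEstimableFromFuture μ x y k (y k)

/-! The argument runs in L² of the circle, modelled by a Hilbert basis `e n` standing for zⁿ. The
isometry zⁿ ↦ w₋ₙ carries z⁻ᵏg and z⁻ᵏh to xₖ and yₖ, so it suffices that g and h lie in the closed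
span M of all z⁻ⁿg, z⁻ⁿh with n > 0.

Suppose one of them does not. Its normalised residual u modulo M is orthogonal to its own
translates, that is |u| = 1, and ūg, ūh have no positive frequencies
(`exists_isWandering_orthogonal`). As h is not cyclic, Beurling's argument
(`exists_isWandering_mem`) gives an inner f' such that the conjugate of f' times h has only negative
frequencies. Multiplying this by ū yields q ≠ 0 with frequencies ≤ 0 and uq with frequencies < 0.
The functions with these two properties form a closed z⁻¹-invariant subspace, which therefore
contains a unimodular ψ. Now ψg = (uψ)(ūg) has only negative frequencies, so the analytic function
conj ψ and its forward translates are orthogonal to g, and g is not cyclic: a contradiction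
(`exists_causal_annihilator_of_isWandering`).

Unimodular functions appear as wandering vectors and multiplication operators as the commutant of
the shift. Passing to unimodular factors keeps every product in L². -/

/-- The isometry that sends a Hilbert basis to a given orthonormal family. -/
noncomputable def HilbertBasis.isometryOfOrthonormal {ι E F : Type*}
    [NormedAddCommGroup E] [InnerProductSpace ℂ E]
    [NormedAddCommGroup F] [InnerProductSpace ℂ F] [CompleteSpace F]
    (e : HilbertBasis ι ℂ E) {v : ι → F} (hv : Orthonormal ℂ v) : E →ₗᵢ[ℂ] F :=
  hv.orthogonalFamily.linearIsometry.comp e.repr.toLinearIsometry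

theorem HilbertBasis.isometryOfOrthonormal_apply_self {ι E F : Type*}
    [NormedAddCommGroup E] [InnerProductSpace ℂ E]
    [NormedAddCommGroup F] [InnerProductSpace ℂ F] [CompleteSpace F]
    (e : HilbertBasis ι ℂ E) {v : ι → F} (hv : Orthonormal ℂ v) (i : ι) :
    e.isometryOfOrthonormal hv (e i) = v i := by
  classical
  show hv.orthogonalFamily.linearIsometry (e.repr (e i)) = v i
  rw [e.repr_self, OrthogonalFamily.linearIsometry_apply_single]
  simp

theorem HilbertBasis.clm_ext {ι E F : Type*}
    [NormedAddCommGroup E] [InnerProductSpace ℂ E]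
    [NormedAddCommGroup F] [InnerProductSpace ℂ F]
    (e : HilbertBasis ι ℂ E) {A B : E →L[ℂ] F} (h : ∀ i, A (e i) = B (e i)) : A = B := by
  refine ContinuousLinearMap.ext_on (s := Set.range e) ?_ ?_
  · exact (Submodule.dense_iff_topologicalClosure_eq_top).2 e.dense_span
  · rintro _ ⟨i, rfl⟩
    exact h i

theorem HilbertBasis.ext_inner {ι E : Type*} [NormedAddCommGroup E] [InnerProductSpace ℂ E]
    (e : HilbertBasis ι ℂ E) {x y : E} (h : ∀ i, inner ℂ (e i) x = inner ℂ (e i) y) : x = y := by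
  apply e.repr.injective
  ext i
  simpa [e.repr_apply_apply] using h i

theorem orthonormal_translate_basis {E : Type*} [NormedAddCommGroup E] [InnerProductSpace ℂ E]
    (e : HilbertBasis ℤ ℂ E) (m : ℤ) : Orthonormal ℂ fun n : ℤ => e (n + m) :=
  e.orthonormal.comp _ (add_left_injective m)

/-- The set of vectors annihilated by a family of bounded functionals. -/
def jointKernel {ι E : Type*} [NormedAddCommGroup E] [InnerProductSpace ℂ E]
     (a : ι → E →L[ℂ] ℂ) : Submodule ℂ E := ⨅ i, (a i).toLinearMap.ker

theorem mem_jointKernel {ι E : Type*} [NormedAddCommGroup E] [InnerProductSpace ℂ E]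
     {a : ι → E →L[ℂ] ℂ} {v : E} :
    v ∈ jointKernel a ↔ ∀ i, a i v = 0 := by
  simp [jointKernel]

theorem isClosed_jointKernel {ι E : Type*} [NormedAddCommGroup E] [InnerProductSpace ℂ E]
     (a : ι → E →L[ℂ] ℂ) :
    IsClosed (jointKernel a : Set E) := by
  have : (jointKernel a : Set E) = ⋂ i, {v | a i v = 0} := by
    ext v
    simp [mem_jointKernel]
  rw [this]
  exact isClosed_iInter fun i => isClosed_eq (a i).continuous continuous_const

/-! ### The bilateral shift, its commutant and its wandering vectors -/

section BilateralShift

variable {E : Type*} [NormedAddCommGroup E] [InnerProductSpace ℂ E] [CompleteSpace E]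
  (e : HilbertBasis ℤ ℂ E)

/-- The `m`-th power of the bilateral shift along a Hilbert basis indexed by `ℤ`. -/
noncomputable def bilateralShift (m : ℤ) : E →ₗᵢ[ℂ] E :=
  e.isometryOfOrthonormal (orthonormal_translate_basis e m)

theorem bilateralShift_basis (m n : ℤ) : bilateralShift e m (e n) = e (n + m) :=
  e.isometryOfOrthonormal_apply_self _ n

theorem bilateralShift_bilateralShift (m n : ℤ) (v : E) :
    bilateralShift e m (bilateralShift e n v) = bilateralShift e (m + n) v := by
  have : (bilateralShift e m).toContinuousLinearMap ∘L (bilateralShift e n).toContinuousLinearMap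
      = (bilateralShift e (m + n)).toContinuousLinearMap := by
    apply e.clm_ext
    intro i
    simp [bilateralShift_basis, add_comm m n, add_assoc]
  exact congrArg (fun A : E →L[ℂ] E => A v) this

theorem bilateralShift_zero (v : E) : bilateralShift e 0 v = v := by
  have : (bilateralShift e 0).toContinuousLinearMap = ContinuousLinearMap.id ℂ E := by
    apply e.clm_ext
    intro i
    simp [bilateralShift_basis]
  exact congrArg (fun A : E →L[ℂ] E => A v) this

theorem inner_bilateralShift_left (m : ℤ) (v v' : E) :
    inner ℂ (bilateralShift e m v) v' = inner ℂ v (bilateralShift e (-m) v') := by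
  rw [← (bilateralShift e (-m)).inner_map_map, bilateralShift_bilateralShift, neg_add_cancel,
    bilateralShift_zero]

theorem inner_bilateralShift_right (m : ℤ) (v v' : E) :
    inner ℂ v (bilateralShift e m v') = inner ℂ (bilateralShift e (-m) v) v' := by
  rw [inner_bilateralShift_left, neg_neg]

theorem inner_basis_bilateralShift (m n : ℤ) (v : E) :
    inner ℂ (e n) (bilateralShift e m v) = inner ℂ (e (n - m)) v := by
  rw [inner_bilateralShift_right, bilateralShift_basis, sub_eq_add_neg]

/-- A bounded operator that commutes with the bilateral shift. -/
def CommutesWithShift (A : E →L[ℂ] E) : Prop :=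
  ∀ (n : ℤ) (v : E), A (bilateralShift e n v) = bilateralShift e n (A v)

variable {e}

theorem commutesWithShift_of_basis {A : E →L[ℂ] E}
    (h : ∀ n, A (e n) = bilateralShift e n (A (e 0))) : CommutesWithShift e A := by
  intro n v
  have : A ∘L (bilateralShift e n).toContinuousLinearMap
      = (bilateralShift e n).toContinuousLinearMap ∘L A := by
    apply e.clm_ext
    intro i
    simp only [ContinuousLinearMap.comp_apply, LinearIsometry.coe_toContinuousLinearMap,
      bilateralShift_basis]
    rw [h, h i, bilateralShift_bilateralShift, add_comm]
  exact congrArg (fun A : E →L[ℂ] E => A v) this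

theorem CommutesWithShift.adjoint {A : E →L[ℂ] E} (hA : CommutesWithShift e A) :
    CommutesWithShift e (ContinuousLinearMap.adjoint A) := by
  intro n v
  refine ext_inner_left ℂ fun y => ?_
  rw [ContinuousLinearMap.adjoint_inner_right, inner_bilateralShift_right,
    inner_bilateralShift_right, ContinuousLinearMap.adjoint_inner_right, hA]

theorem CommutesWithShift.apply_basis {A : E →L[ℂ] E} (hA : CommutesWithShift e A) (n : ℤ) :
    A (e n) = bilateralShift e n (A (e 0)) := by
  rw [← hA, bilateralShift_basis, zero_add]

/-- An operator in the commutant is multiplication by its symbol `A (e 0)`, so on coefficients it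
acts by convolution. Commutativity and all support estimates are read off from this. -/
theorem CommutesWithShift.hasSum_inner {A : E →L[ℂ] E} (hA : CommutesWithShift e A) (n : ℤ)
    (b : E) : HasSum (fun k : ℤ => inner ℂ (e k) b * inner ℂ (e (n - k)) (A (e 0)))
      (inner ℂ (e n) (A b)) := by
  have h := ((innerSL ℂ (e n)) ∘L A).hasSum (e.hasSum_repr b)
  have hfun : (fun k : ℤ => inner ℂ (e k) b * inner ℂ (e (n - k)) (A (e 0))) =
      fun k => ((innerSL ℂ (e n)) ∘L A) (e.repr b k • e k) := by
    funext k
    rw [map_smul, ContinuousLinearMap.comp_apply, innerSL_apply_apply, hA.apply_basis k,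
      inner_basis_bilateralShift, e.repr_apply_apply, smul_eq_mul]
  rw [hfun]
  exact h

/-- The commutant of the bilateral shift is commutative. -/
theorem CommutesWithShift.comm {A B : E →L[ℂ] E} (hA : CommutesWithShift e A)
    (hB : CommutesWithShift e B) (v : E) : A (B v) = B (A v) := by
  have h0 : A (B (e 0)) = B (A (e 0)) := by
    refine e.ext_inner fun n => ?_
    have h1 := hA.hasSum_inner n (B (e 0))
    -- Substituting k ↦ n - k exchanges the two factors of the convolution.
    have h2 := (Equiv.subLeft n).hasSum_iff.2 (hB.hasSum_inner n (A (e 0)))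
    refine h1.unique ?_
    convert h2 using 2 with k
    simp [mul_comm]
  have : A ∘L B = B ∘L A := by
    apply e.clm_ext
    intro n
    simp only [ContinuousLinearMap.comp_apply]
    rw [hB.apply_basis, hA.apply_basis n, hA, hB, h0]
  exact congrArg (fun A : E →L[ℂ] E => A v) this

variable (e) in
/-- A unit vector whose translates under the bilateral shift are orthonormal. -/
def IsWandering (f : E) : Prop := Orthonormal ℂ fun n : ℤ => bilateralShift e n f

theorem isWandering_of_inner_eq_zero {f : E} (hf : ‖f‖ = 1)
    (h : ∀ n : ℤ, n ≠ 0 → inner ℂ (bilateralShift e n f) f = 0) : IsWandering e f := by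
  refine ⟨fun n => by rw [LinearIsometry.norm_map, hf], fun m n hmn => ?_⟩
  show inner ℂ (bilateralShift e m f) (bilateralShift e n f) = 0
  rw [inner_bilateralShift_right, bilateralShift_bilateralShift]
  exact h _ (by intro h; apply hmn; lia)

/-- Autocorrelations at opposite lags are conjugate, so one sign of the lag suffices. The sign `s`
(`s * s = 1` forces ±1) lets forward and backward shifts be treated together. -/
theorem isWandering_of_forall_pos {f : E} (hf : ‖f‖ = 1) {s : ℤ} (hs : s * s = 1)
    (h : ∀ n : ℤ, 0 < n → inner ℂ (bilateralShift e (s * n) f) f = 0) : IsWandering e f := by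
  have h' : ∀ n : ℤ, 0 < n → inner ℂ (bilateralShift e (s * -n) f) f = 0 := by
    intro n hn
    rw [inner_bilateralShift_left, ← inner_conj_symm, mul_neg, neg_neg, h n hn, map_zero]
  refine isWandering_of_inner_eq_zero hf fun n hn => ?_
  have hsn : n = s * (s * n) := by rw [← mul_assoc, hs, one_mul]
  have h0 : s * n ≠ 0 := by intro h0; rw [h0, mul_zero] at hsn; exact hn hsn
  rw [hsn]
  rcases lt_or_gt_of_ne h0 with h1 | h1
  · simpa using h' (-(s * n)) (by lia)
  · exact h _ h1

/-- Multiplication by a wandering vector, as an isometry. -/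
noncomputable def IsWandering.mul {f : E} (hf : IsWandering e f) : E →L[ℂ] E :=
  (e.isometryOfOrthonormal hf).toContinuousLinearMap

theorem IsWandering.mul_basis {f : E} (hf : IsWandering e f) (n : ℤ) :
    hf.mul (e n) = bilateralShift e n f :=
  e.isometryOfOrthonormal_apply_self hf n

theorem IsWandering.mul_basis_zero {f : E} (hf : IsWandering e f) : hf.mul (e 0) = f := by
  rw [hf.mul_basis, bilateralShift_zero]

theorem IsWandering.commutesWithShift_mul {f : E} (hf : IsWandering e f) :
    CommutesWithShift e hf.mul :=
  commutesWithShift_of_basis fun n => by rw [hf.mul_basis_zero, hf.mul_basis]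

theorem IsWandering.adjoint_mul_apply {f : E} (hf : IsWandering e f) (v : E) :
    ContinuousLinearMap.adjoint hf.mul (hf.mul v) = v := by
  refine ext_inner_left ℂ fun y => ?_
  rw [ContinuousLinearMap.adjoint_inner_right]
  exact LinearIsometry.inner_map_map (e.isometryOfOrthonormal hf) y v

/-- The isometry is unitary because it commutes with its adjoint, both being in the commutant of the
shift. -/
theorem IsWandering.mul_adjoint_apply {f : E} (hf : IsWandering e f) (v : E) :
    hf.mul (ContinuousLinearMap.adjoint hf.mul v) = v := by
  rw [hf.commutesWithShift_mul.comm hf.commutesWithShift_mul.adjoint, hf.adjoint_mul_apply]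

theorem IsWandering.inner_basis_adjoint {f : E} (hf : IsWandering e f) (n : ℤ) (v : E) :
    inner ℂ (e n) (ContinuousLinearMap.adjoint hf.mul v) = inner ℂ (bilateralShift e n f) v := by
  rw [ContinuousLinearMap.adjoint_inner_right, hf.mul_basis]

/-- If a vector is supported on indices `≤ 0`, and a shift-commuting operator sends `e 0` to a vector
supported below `m`, then so is the image. -/
theorem CommutesWithShift.inner_basis_eq_zero {A : E →L[ℂ] E} (hA : CommutesWithShift e A)
    {m : ℤ} (h0 : ∀ n, m ≤ n → inner ℂ (e n) (A (e 0)) = 0) {b : E}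
    (hb : ∀ n, 0 < n → inner ℂ (e n) b = 0) {n : ℤ} (hn : m ≤ n) :
    inner ℂ (e n) (A b) = 0 := by
  refine (hA.hasSum_inner n b).unique ?_
  convert hasSum_zero with k
  rcases lt_or_ge 0 k with hk | hk
  · rw [hb k hk, zero_mul]
  · rw [h0 _ (by lia), mul_zero]

/-- The Beurling-Lax argument: a nonzero closed subspace that is invariant under a power of the shift
and whose elements have coefficients only on a half line contains a wandering vector. -/
theorem exists_isWandering_mem {Q : Submodule ℂ E} (hQc : IsClosed (Q : Set E)) (hQ : Q ≠ ⊥)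
    {s : ℤ} (hs : s * s = 1) (hinv : ∀ v ∈ Q, bilateralShift e s v ∈ Q)
    (hsupp : ∀ v ∈ Q, ∀ n : ℤ, n < 0 → inner ℂ (e (s * n)) v = 0) :
    ∃ f ∈ Q, IsWandering e f := by
  have hpow : ∀ (n : ℕ), ∀ v ∈ Q, bilateralShift e (s * n) v ∈ Q := by
    intro n
    induction n with
    | zero => intro v hv; simpa [bilateralShift_zero] using hv
    | succ n ih =>
      intro v hv
      have := hinv _ (ih v hv)
      rw [bilateralShift_bilateralShift] at this
      rwa [show s + s * (n : ℤ) = s * ((n + 1 : ℕ) : ℤ) by push_cast; ring] at this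
  set R : Submodule ℂ E := Q.map (bilateralShift e s).toLinearMap with hR
  have hRcl : IsComplete (R : Set E) := by
    have : IsComplete (Q : Set E) := hQc.isComplete
    rw [hR, Submodule.map_coe]
    exact (isComplete_image_iff (bilateralShift e s).isometry.isUniformInducing).2 this
  have : CompleteSpace R := hRcl.completeSpace_coe
  -- If shifting loses nothing, Q is also invariant under the inverse shift; pushing any coefficient
  -- into the forbidden half line then shows that it vanishes, so Q = 0.
  by_cases hRQ : Q ≤ R
  · exfalso
    have hback : ∀ v ∈ Q, bilateralShift e (-s) v ∈ Q := by
      intro v hv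
      obtain ⟨v', hv', rfl⟩ := hRQ hv
      simpa [bilateralShift_bilateralShift, bilateralShift_zero] using hv'
    have hbackpow : ∀ (n : ℕ), ∀ v ∈ Q, bilateralShift e (-s * n) v ∈ Q := by
      intro n
      induction n with
      | zero => intro v hv; simpa [bilateralShift_zero] using hv
      | succ n ih =>
        intro v hv
        have := hback _ (ih v hv)
        rw [bilateralShift_bilateralShift] at this
        rwa [show -s + -s * (n : ℤ) = -s * ((n + 1 : ℕ) : ℤ) by push_cast; ring] at this
    apply hQ
    rw [Submodule.eq_bot_iff]
    intro v hv
    refine e.ext_inner fun k => ?_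
    obtain ⟨n, hn⟩ : ∃ n : ℕ, s * k < n := ⟨(s * k).toNat + 1, by lia⟩
    have := hsupp _ (hbackpow n v hv) (s * k - n) (by lia)
    rw [inner_basis_bilateralShift] at this
    have hk : s * (s * k - n) - -s * n = k := by linear_combination k * hs
    rw [inner_zero_right, ← this, hk]
  -- Otherwise a residual d in Q orthogonal to R works: its strictly shifted copies lie in R.
  · obtain ⟨v, hv, hvR⟩ := Set.not_subset.1 hRQ
    set p : E := R.starProjection v with hp
    have hpR : p ∈ R := Submodule.starProjection_apply_mem R v
    have hRQ' : R ≤ Q := by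
      rintro _ ⟨v', hv', rfl⟩
      exact hinv v' hv'
    set d := v - p with hd
    have hd0 : d ≠ 0 := by
      intro h
      rw [sub_eq_zero] at h
      exact hvR (h ▸ hpR)
    have hdQ : d ∈ Q := Q.sub_mem hv (hRQ' hpR)
    have hdo : ∀ r ∈ R, inner ℂ r d = 0 :=
      (Submodule.mem_orthogonal R d).1 (Submodule.sub_starProjection_mem_orthogonal v)
    have hnd : (‖d‖ : ℂ) ≠ 0 := by simpa using hd0
    refine ⟨(‖d‖ : ℂ)⁻¹ • d, Q.smul_mem _ hdQ, isWandering_of_forall_pos ?_ hs ?_⟩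
    · rw [norm_smul, norm_inv]
      simp [hd0]
    · intro n hn
      have hmem : bilateralShift e (s * n) d ∈ R := by
        refine ⟨bilateralShift e (s * (n - 1).toNat) d, hpow _ d hdQ, ?_⟩
        show bilateralShift e s _ = _
        rw [bilateralShift_bilateralShift]
        congr 2
        rw [Int.toNat_of_nonneg (by lia)]
        ring
      rw [map_smul, inner_smul_left, inner_smul_right, hdo _ hmem, mul_zero, mul_zero]

/-- If `h ≠ 0` is annihilated by all forward translates of a nonzero causal vector, and `g`, `h` are
both orthogonal to all strictly forward translates of a wandering vector, then `g` is annihilated by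
all forward translates of a nonzero causal vector. -/
theorem exists_causal_annihilator_of_isWandering {g h u f : E} (hh0 : h ≠ 0) (hu : IsWandering e u)
    (hug : ∀ n : ℤ, 0 < n → inner ℂ (bilateralShift e n u) g = 0)
    (huh : ∀ n : ℤ, 0 < n → inner ℂ (bilateralShift e n u) h = 0)
    (hf0 : f ≠ 0) (hf : ∀ n : ℤ, n < 0 → inner ℂ (e n) f = 0)
    (hfh : ∀ n : ℤ, 0 ≤ n → inner ℂ (bilateralShift e n f) h = 0) :
    ∃ φ : E, φ ≠ 0 ∧ (∀ n : ℤ, n < 0 → inner ℂ (e n) φ = 0) ∧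
      ∀ n : ℤ, 0 ≤ n → inner ℂ (bilateralShift e n φ) g = 0 := by
  -- Replace f by an inner function, so that multiplication by its conjugate is bounded.
  obtain ⟨f', hf', hfw⟩ : ∃ f' : E, ((∀ n : ℤ, n < 0 → inner ℂ (e n) f' = 0) ∧
      ∀ n : ℤ, 0 ≤ n → inner ℂ (bilateralShift e n f') h = 0) ∧ IsWandering e f' := by
    set K : Submodule ℂ E := jointKernel (ι := {n : ℤ // n < 0}) (fun n => innerSL ℂ (e n)) ⊓
      jointKernel (ι := {n : ℤ // 0 ≤ n}) (fun n => innerSL ℂ (bilateralShift e (-n) h)) with hK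
    have hmem : ∀ v, v ∈ K ↔ (∀ n : ℤ, n < 0 → inner ℂ (e n) v = 0) ∧
        ∀ n : ℤ, 0 ≤ n → inner ℂ (bilateralShift e n v) h = 0 := by
      intro v
      simp only [hK, Submodule.mem_inf, mem_jointKernel, innerSL_apply_apply, Subtype.forall]
      refine and_congr Iff.rfl (forall₂_congr fun n _ => ?_)
      rw [inner_bilateralShift_left, neg_neg, inner_eq_zero_symm]
    obtain ⟨f', hf'K, hw⟩ := exists_isWandering_mem (e := e) (Q := K) (s := 1)
      ((isClosed_jointKernel _).inter (isClosed_jointKernel _))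
      (fun hbot => hf0 ((Submodule.eq_bot_iff K).1 hbot f ((hmem f).2 ⟨hf, hfh⟩))) (by norm_num)
      (by
        intro v hv
        rw [hmem] at hv ⊢
        refine ⟨fun n hn => ?_, fun n hn => ?_⟩
        · rw [inner_basis_bilateralShift]
          exact hv.1 _ (by lia)
        · rw [bilateralShift_bilateralShift]
          exact hv.2 _ (by lia))
      (by
        intro v hv n hn
        rw [one_mul]
        exact ((hmem v).1 hv).1 n hn)
    exact ⟨f', (hmem f').1 hf'K, hw⟩
  set T := hu.mul with hT
  set V := hfw.mul with hV
  have cT : CommutesWithShift e T := hu.commutesWithShift_mul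
  have cV := hfw.commutesWithShift_mul.adjoint
  set B := ContinuousLinearMap.adjoint T h with hB
  have hBneg : ∀ n : ℤ, 0 < n → inner ℂ (e n) B = 0 := fun n hn => by
    rw [hB, hu.inner_basis_adjoint, huh n hn]
  -- Here q is h times the conjugates of u and f'; it witnesses that the subspace used to find ψ is
  -- nonzero.
  set q := ContinuousLinearMap.adjoint V B with hq
  have hTq : T q = ContinuousLinearMap.adjoint V h := by
    rw [hq, cT.comm cV, hB, hu.mul_adjoint_apply]
  have hq0 : q ≠ 0 := by
    intro h0
    apply hh0
    rw [← hfw.mul_adjoint_apply h, ← hV, ← hTq, h0, map_zero, map_zero]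
  have hV0 : ∀ n : ℤ, 1 ≤ n → inner ℂ (e n) (ContinuousLinearMap.adjoint V (e 0)) = 0 := by
    intro n hn
    rw [hfw.inner_basis_adjoint, inner_bilateralShift_left, bilateralShift_basis,
      inner_eq_zero_symm]
    exact hf'.1 _ (by lia)
  -- Beurling's argument for the backward shift, hence `s := -1`: ψ is the conjugate of an inner
  -- function, and uψ has only negative frequencies.
  obtain ⟨ψ, hψ, hψw⟩ : ∃ ψ : E, ((∀ n : ℤ, 0 < n → inner ℂ (e n) ψ = 0) ∧
      ∀ n : ℤ, 0 ≤ n → inner ℂ (e n) (T ψ) = 0) ∧ IsWandering e ψ := by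
    set K : Submodule ℂ E := jointKernel (ι := {n : ℤ // 0 < n}) (fun n => innerSL ℂ (e n)) ⊓
      jointKernel (ι := {n : ℤ // 0 ≤ n}) (fun n => innerSL ℂ (e n) ∘L T) with hK
    have hmem : ∀ v, v ∈ K ↔ (∀ n : ℤ, 0 < n → inner ℂ (e n) v = 0) ∧
        ∀ n : ℤ, 0 ≤ n → inner ℂ (e n) (T v) = 0 := by
      intro v
      simp only [hK, Submodule.mem_inf, mem_jointKernel, innerSL_apply_apply, Subtype.forall,
        ContinuousLinearMap.comp_apply]
    have hqK : q ∈ K := by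
      refine (hmem q).2 ⟨fun n hn => cV.inner_basis_eq_zero hV0 hBneg hn, fun n hn => ?_⟩
      rw [hTq, hfw.inner_basis_adjoint, hf'.2 n hn]
    obtain ⟨ψ, hψK, hw⟩ := exists_isWandering_mem (e := e) (Q := K) (s := -1)
      ((isClosed_jointKernel _).inter (isClosed_jointKernel _))
      (fun hbot => hq0 ((Submodule.eq_bot_iff K).1 hbot q hqK)) (by norm_num)
      (by
        intro v hv
        rw [hmem] at hv ⊢
        refine ⟨fun n hn => ?_, fun n hn => ?_⟩
        · rw [inner_basis_bilateralShift]
          exact hv.1 _ (by lia)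
        · rw [cT, inner_basis_bilateralShift]
          exact hv.2 _ (by lia))
      (by
        intro v hv n hn
        exact ((hmem v).1 hv).1 _ (by lia))
    exact ⟨ψ, (hmem ψ).1 hψK, hw⟩
  set W := hψw.mul with hW
  have cW : CommutesWithShift e W := hψw.commutesWithShift_mul
  have cWT : CommutesWithShift e (W ∘L T) := fun n v => by
    simp only [ContinuousLinearMap.comp_apply]
    rw [cT, cW]
  have hWT0 : (W ∘L T) (e 0) = T ψ := by
    rw [ContinuousLinearMap.comp_apply, cW.comm cT, hW, hψw.mul_basis_zero]
  have hWg : ∀ n : ℤ, 0 ≤ n → inner ℂ (e n) (W g) = 0 := by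
    intro n hn
    -- Factor ψg = (uψ)(ūg): frequencies < 0 times frequencies ≤ 0.
    rw [← hu.mul_adjoint_apply g]
    refine cWT.inner_basis_eq_zero (m := 0) ?_ ?_ hn
    · intro k hk
      rw [hWT0, hψ.2 k hk]
    · intro k hk
      rw [hu.inner_basis_adjoint, hug k hk]
  -- The annihilator is the conjugate of ψ, written as the adjoint multiplication applied to 1.
  refine ⟨ContinuousLinearMap.adjoint W (e 0), ?_, ?_, ?_⟩
  · intro h0
    have h1 := hψw.mul_adjoint_apply (e 0)
    rw [← hW, h0, map_zero] at h1
    have := e.orthonormal.1 0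
    rw [← h1, norm_zero] at this
    exact zero_ne_one this
  · intro n hn
    rw [hψw.inner_basis_adjoint, inner_bilateralShift_left, bilateralShift_basis,
      inner_eq_zero_symm]
    exact hψ.1 _ (by lia)
  · intro n hn
    rw [← cW.adjoint, bilateralShift_basis, zero_add, ContinuousLinearMap.adjoint_inner_left]
    exact hWg n hn

/-- If an element of a set does not lie in the closed span `M` of the strictly backward translates of
the set, there is a wandering vector orthogonal to `M`. -/
theorem exists_isWandering_orthogonal {G : Set E} {M : Submodule ℂ E}
    (hM : M = (Submodule.span ℂ {z | ∃ v ∈ G, ∃ n : ℤ, 0 < n ∧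
      bilateralShift e (-n) v = z}).topologicalClosure) {g : E} (hg : g ∈ G) (hgM : g ∉ M) :
    ∃ u : E, IsWandering e u ∧ ∀ v ∈ G, ∀ n : ℤ, 0 < n → inner ℂ (bilateralShift e n u) v = 0 := by
  have hMc : IsClosed (M : Set E) := hM ▸ Submodule.isClosed_topologicalClosure _
  have : CompleteSpace M := hMc.completeSpace_coe
  have hgen : ∀ v ∈ G, ∀ n : ℤ, 0 < n → bilateralShift e (-n) v ∈ M := by
    intro v hv n hn
    rw [hM]
    exact Submodule.le_topologicalClosure _ (Submodule.subset_span ⟨v, hv, n, hn, rfl⟩)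
  have hinv : ∀ n : ℤ, 0 < n → ∀ z ∈ M, bilateralShift e (-n) z ∈ M := by
    intro n hn
    suffices h : M ≤ M.comap (bilateralShift e (-n)).toLinearMap from fun z hz => h hz
    conv_lhs => rw [hM]
    refine Submodule.topologicalClosure_minimal _ (Submodule.span_le.2 ?_)
      (hMc.preimage (bilateralShift e (-n)).continuous)
    rintro _ ⟨v, hv, k, hk, rfl⟩
    show bilateralShift e (-n) (bilateralShift e (-k) v) ∈ M
    rw [bilateralShift_bilateralShift, ← neg_add]
    exact hgen v hv _ (by lia)
  set p : E := M.starProjection g with hp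
  have hpM : p ∈ M := Submodule.starProjection_apply_mem M g
  set d := g - p with hd
  have hd0 : d ≠ 0 := by
    intro h
    rw [sub_eq_zero] at h
    exact hgM (h ▸ hpM)
  have hdo : ∀ r ∈ M, inner ℂ d r = 0 := fun r hr => by
    rw [inner_eq_zero_symm]
    exact (Submodule.mem_orthogonal M d).1 (Submodule.sub_starProjection_mem_orthogonal g) r hr
  refine ⟨(‖d‖ : ℂ)⁻¹ • d, isWandering_of_forall_pos (s := 1) ?_ (by norm_num) ?_, ?_⟩
  · rw [norm_smul, norm_inv]
    simp [hd0]
  · intro n hn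
    rw [one_mul, map_smul, inner_smul_left, inner_smul_right, inner_bilateralShift_left,
      hdo, mul_zero, mul_zero]
    -- The backward translates of d lie in M: those of g by construction, those of p by invariance
    -- of M.
    rw [hd, map_sub]
    exact M.sub_mem (hgen g hg n hn) (hinv n hn p hpM)
  · intro v hv n hn
    rw [map_smul, inner_smul_left, inner_bilateralShift_left, hdo _ (hgen v hv n hn), mul_zero]

end BilateralShift
-- Cyclicity for the backward shift
/-- The standard Hilbert basis of `ℓ²(ι)`. -/
noncomputable def lpStandardBasis (ι : Type*) : HilbertBasis ι ℂ (lp (fun _ : ι => ℂ) 2) :=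
  HilbertBasis.ofRepr (LinearIsometryEquiv.refl ℂ _)

theorem backwardShift_pow_apply (n : ℕ) (f : HardyTwo) (l : ℕ) :
    ((backwardShift ^ n) f) l = f (l + n) := by
  induction n generalizing l with
  | zero => simp
  | succ n ih =>
    rw [pow_succ']
    show ((backwardShift ^ n) f) (l + 1) = _
    rw [ih, add_right_comm, add_assoc]

theorem not_isCyclicVector_iff {F : Type*} [NormedAddCommGroup F] [InnerProductSpace ℂ F]
    [CompleteSpace F] {A : F →L[ℂ] F} {f : F} :
    ¬ IsCyclicVector A f ↔ ∃ v ≠ 0, ∀ n : ℕ, inner ℂ ((A ^ n) f) v = 0 := by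
  rw [IsCyclicVector, Submodule.topologicalClosure_eq_top_iff, Submodule.eq_bot_iff]
  push Not
  refine exists_congr fun v => ?_
  rw [and_comm]
  refine and_congr Iff.rfl ?_
  rw [← Submodule.span_singleton_le_iff_mem, ← Submodule.isOrtho_iff_le, Submodule.isOrtho_comm,
    Submodule.isOrtho_span]
  simp

/-! ### The Hardy space inside the bilateral sequence space -/

section CausalEmbedding

variable {E : Type*} [NormedAddCommGroup E] [InnerProductSpace ℂ E] [CompleteSpace E]
  (e : HilbertBasis ℤ ℂ E)

/-- The isometric embedding of `ℓ²(ℕ)` as the vectors supported on nonnegative indices. -/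
noncomputable def causalEmbedding : HardyTwo →ₗᵢ[ℂ] E :=
  (lpStandardBasis ℕ).isometryOfOrthonormal (v := fun n : ℕ => e (n : ℤ))
    (e.orthonormal.comp _ Nat.cast_injective)

theorem causalEmbedding_basis (n : ℕ) : causalEmbedding e (lpStandardBasis ℕ n) = e (n : ℤ) :=
  (lpStandardBasis ℕ).isometryOfOrthonormal_apply_self _ n

theorem hasSum_causalEmbedding (f : HardyTwo) :
    HasSum (fun l : ℕ => f l • e (l : ℤ)) (causalEmbedding e f) := by
  have h := (causalEmbedding e).toContinuousLinearMap.hasSum ((lpStandardBasis ℕ).hasSum_repr f)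
  have hfun : (fun l : ℕ => f l • e (l : ℤ)) = fun l => (causalEmbedding e).toContinuousLinearMap
      ((lpStandardBasis ℕ).repr f l • lpStandardBasis ℕ l) := by
    funext l
    rw [map_smul, LinearIsometry.coe_toContinuousLinearMap, causalEmbedding_basis]
    rfl
  rw [hfun]
  exact h

theorem inner_basis_causalEmbedding (n : ℕ) (f : HardyTwo) :
    inner ℂ (e (n : ℤ)) (causalEmbedding e f) = f n := by
  rw [← causalEmbedding_basis, LinearIsometry.inner_map_map, ← HilbertBasis.repr_apply_apply]
  rfl

theorem inner_basis_causalEmbedding_of_neg {k : ℤ} (hk : k < 0) (f : HardyTwo) :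
    inner ℂ (e k) (causalEmbedding e f) = 0 := by
  have h := (innerSL ℂ (e k)).hasSum (hasSum_causalEmbedding e f)
  refine h.unique ?_
  convert hasSum_zero with l
  rw [map_smul, innerSL_apply_apply, e.orthonormal.2 (by lia), smul_zero]

theorem exists_causalEmbedding_eq {v : E} (hv : ∀ n : ℤ, n < 0 → inner ℂ (e n) v = 0) :
    ∃ f, causalEmbedding e f = v := by
  refine ⟨ContinuousLinearMap.adjoint (causalEmbedding e).toContinuousLinearMap v, ?_⟩
  refine e.ext_inner fun k => ?_
  rcases lt_or_ge k 0 with hk | hk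
  · rw [inner_basis_causalEmbedding_of_neg e hk, hv k hk]
  · lift k to ℕ using hk
    rw [← causalEmbedding_basis, LinearIsometry.inner_map_map,
      ContinuousLinearMap.adjoint_inner_right]
    rfl

/-- The backward shift is z⁻¹ followed by truncation to nonnegative frequencies; the truncation is
invisible when pairing with a causal vector. -/
theorem inner_backwardShift_pow (n : ℕ) (h f : HardyTwo) :
    inner ℂ ((backwardShift ^ n) h) f =
      inner ℂ (bilateralShift e (-n) (causalEmbedding e h)) (causalEmbedding e f) := by
  have h1 := lp.hasSum_inner (𝕜 := ℂ) ((backwardShift ^ n) h) f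
  have h2 := (innerSL ℂ (bilateralShift e (-n) (causalEmbedding e h))).hasSum
    (hasSum_causalEmbedding e f)
  refine h1.unique ?_
  rw [innerSL_apply_apply] at h2
  convert h2 with l
  rw [backwardShift_pow_apply, map_smul, innerSL_apply_apply, ← inner_conj_symm (_ : E),
    inner_basis_bilateralShift, sub_neg_eq_add, ← Nat.cast_add, inner_basis_causalEmbedding]
  simp

theorem not_isCyclicVector_backwardShift_iff {h : HardyTwo} :
    ¬ IsCyclicVector backwardShift h ↔ ∃ φ : E, φ ≠ 0 ∧ (∀ n : ℤ, n < 0 → inner ℂ (e n) φ = 0) ∧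
      ∀ n : ℤ, 0 ≤ n → inner ℂ (bilateralShift e n φ) (causalEmbedding e h) = 0 := by
  rw [not_isCyclicVector_iff]
  constructor
  · rintro ⟨f, hf0, hf⟩
    refine ⟨causalEmbedding e f, ?_, fun n hn => inner_basis_causalEmbedding_of_neg e hn f, ?_⟩
    · exact (map_ne_zero_iff _ (causalEmbedding e).injective).2 hf0
    · intro n hn
      lift n to ℕ using hn
      rw [inner_bilateralShift_left, inner_eq_zero_symm, ← inner_backwardShift_pow, hf]
  · rintro ⟨φ, hφ0, hφ, hn⟩
    obtain ⟨f, rfl⟩ := exists_causalEmbedding_eq e hφ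
    refine ⟨f, fun h0 => hφ0 (by rw [h0, map_zero]), fun n => ?_⟩
    rw [inner_backwardShift_pow e, inner_eq_zero_symm, ← inner_bilateralShift_left]
    exact hn n (by positivity)

/-- If `g` is cyclic and `h ≠ 0` is not, the closed span of the strictly backward translates of `g`
and `h` contains both `g` and `h`. -/
theorem causalEmbedding_mem_closure_span {g h : HardyTwo} (hg : IsCyclicVector backwardShift g)
    (hh0 : h ≠ 0) (hh : ¬ IsCyclicVector backwardShift h) :
    ∀ v ∈ ({causalEmbedding e g, causalEmbedding e h} : Set E), v ∈ (Submodule.span ℂ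
      {z | ∃ v ∈ ({causalEmbedding e g, causalEmbedding e h} : Set E), ∃ n : ℤ, 0 < n ∧
        bilateralShift e (-n) v = z}).topologicalClosure := by
  intro v hv
  by_contra hvM
  obtain ⟨u, hu, huv⟩ := exists_isWandering_orthogonal (e := e) rfl hv hvM
  obtain ⟨f, hf0, hf, hfh⟩ := (not_isCyclicVector_backwardShift_iff e).1 hh
  exact (not_isCyclicVector_backwardShift_iff e).2 (exists_causal_annihilator_of_isWandering
    ((map_ne_zero_iff _ (causalEmbedding e).injective).2 hh0) hu (huv _ (by simp)) (huv _ (by simp))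
    hf0 hf hfh) hg

end CausalEmbedding

/-! ### From sequences to random variables -/

section WhiteNoise

variable {Ω : Type*} [MeasurableSpace Ω] {μ : Measure Ω}

/-- Time is reversed so that `e l` with `l ≥ 0` corresponds to the past noise entering a causal
filter. -/
theorem IsWhiteNoise.orthonormal {w : ℤ → Ω → ℂ} (hw : IsWhiteNoise μ w) :
    Orthonormal ℂ fun n : ℤ => (hw.memLp (-n)).toLp (w (-n)) := by
  rw [orthonormal_iff_ite]
  intro i j
  rw [L2.inner_def]
  have hcov := hw.covariance (-j) (-i)
  rw [show (if i = j then (1 : ℂ) else 0) = if -j = -i then 1 else 0 by simp [eq_comm], ← hcov]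
  refine integral_congr_ae ?_
  filter_upwards [(hw.memLp (-i)).coeFn_toLp, (hw.memLp (-j)).coeFn_toLp] with ω h1 h2
  rw [h1, h2]
  simp

/-- The spectral isometry that sends the basis vector `e n` to the noise `w (-n)`. -/
noncomputable def IsWhiteNoise.isometry {w : ℤ → Ω → ℂ} (hw : IsWhiteNoise μ w) :
    lp (fun _ : ℤ => ℂ) 2 →ₗᵢ[ℂ] Lp ℂ 2 μ :=
  (lpStandardBasis ℤ).isometryOfOrthonormal hw.orthonormal

theorem IsWhiteNoise.isometry_basis {w : ℤ → Ω → ℂ} (hw : IsWhiteNoise μ w) (n : ℤ) :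
    hw.isometry (lpStandardBasis ℤ n) = (hw.memLp (-n)).toLp (w (-n)) :=
  (lpStandardBasis ℤ).isometryOfOrthonormal_apply_self _ n

theorem eLpNorm_sub_eq_of_ae {F G : Ω → ℂ} (hF : MemLp F 2 μ) {v : Lp ℂ 2 μ} (hG : G =ᵐ[μ] v) :
    eLpNorm (fun ω => F ω - G ω) 2 μ = edist (hF.toLp F) v := by
  rw [Lp.edist_def]
  refine eLpNorm_congr_ae ?_
  filter_upwards [hF.coeFn_toLp, hG] with ω h1 h2
  rw [Pi.sub_apply, h1, h2]

theorem coeFn_sum_smul {ι : Type*} (s : Finset ι) (c : ι → ℂ) (X : ι → Ω → ℂ)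
    (hX : ∀ i, MemLp (X i) 2 μ) :
    (fun ω => ∑ i ∈ s, c i * X i ω) =ᵐ[μ] (∑ i ∈ s, c i • (hX i).toLp (X i) : Lp ℂ 2 μ) := by
  classical
  induction s using Finset.induction_on with
  | empty =>
    simp only [Finset.sum_empty]
    exact (Lp.coeFn_zero ℂ 2 μ).symm
  | insert i s hi ih =>
    rw [Finset.sum_insert hi]
    filter_upwards [Lp.coeFn_add (c i • (hX i).toLp (X i)) (∑ i ∈ s, c i • (hX i).toLp (X i)),
      Lp.coeFn_smul (c i) ((hX i).toLp (X i)), (hX i).coeFn_toLp, ih] with ω h1 h2 h3 h4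
    rw [Finset.sum_insert hi, h1, Pi.add_apply, h2, Pi.smul_apply, h3, h4, smul_eq_mul]

theorem IsCausalFilterOutput.isometry_eq {w : ℤ → Ω → ℂ} (hw : IsWhiteNoise μ w) {c : HardyTwo}
    {x : ℤ → Ω → ℂ} (hx : IsCausalFilterOutput μ w (fun l => c l) x) (k : ℤ) :
    hw.isometry (bilateralShift (lpStandardBasis ℤ) (-k) (causalEmbedding (lpStandardBasis ℤ) c)) =
      (hx k).1.toLp (x k) := by
  have h1 := (hw.isometry.toContinuousLinearMap ∘L
    (bilateralShift (lpStandardBasis ℤ) (-k)).toContinuousLinearMap).hasSum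
    (hasSum_causalEmbedding (lpStandardBasis ℤ) c)
  have h2 := h1.tendsto_sum_nat
  refine tendsto_nhds_unique h2 ?_
  rw [tendsto_iff_edist_tendsto_0]
  refine (hx k).2.congr fun n => ?_
  rw [edist_comm]
  apply eLpNorm_sub_eq_of_ae
  refine (coeFn_sum_smul (Finset.range n) (fun l => c l) (fun l : ℕ => w (k - l))
    fun l => hw.memLp _).trans (Eventually.of_forall fun ω => ?_)
  congr 2
  refine Finset.sum_congr rfl fun l _ => ?_
  simp only [map_smul, ContinuousLinearMap.comp_apply, LinearIsometry.coe_toContinuousLinearMap,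
    bilateralShift_basis, hw.isometry_basis]
  simp only [show -((l : ℤ) + -k) = k - l by ring]

/-- A variable in the closed span of the future values is estimable from the future. -/
theorem isEstimableFromFuture_of_mem_closure_span {x y : ℤ → Ω → ℂ} (hx : ∀ k, MemLp (x k) 2 μ)
    (hy : ∀ k, MemLp (y k) 2 μ) {k : ℤ} {v : Ω → ℂ} (hv : MemLp v 2 μ)
    (h : hv.toLp v ∈ (Submodule.span ℂ
      (Set.range (fun l : ℕ => (hx (k + (l + 1 : ℕ))).toLp (x (k + (l + 1 : ℕ)))) ∪
        Set.range fun l : ℕ => (hy (k + (l + 1 : ℕ))).toLp (y (k + (l + 1 : ℕ))))).topologicalClosure) :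
    IsEstimableFromFuture μ x y k v := by
  intro ε hε
  obtain ⟨z, hz, hvz⟩ := EMetric.mem_closure_iff.1 h (ENNReal.ofReal ε) (by simpa using hε)
  replace hz : z ∈ Submodule.span ℂ _ := hz
  rw [Submodule.span_union, Submodule.mem_sup] at hz
  obtain ⟨z₁, hz₁, z₂, hz₂, rfl⟩ := hz
  obtain ⟨a, rfl⟩ := (Finsupp.mem_span_range_iff_exists_finsupp).1 hz₁
  obtain ⟨b, rfl⟩ := (Finsupp.mem_span_range_iff_exists_finsupp).1 hz₂
  obtain ⟨n, hn⟩ := (a.support ∪ b.support).exists_nat_subset_range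
  -- The coefficients from the span are indexed from 0 and the lags from 1; truncated subtraction is
  -- harmless since the sum starts at `l = 1`.
  refine ⟨n, fun l => a (l - 1), fun l => b (l - 1), ?_⟩
  convert hvz using 1
  apply eLpNorm_sub_eq_of_ae
  have ha : a.support ⊆ Finset.range n := Finset.subset_union_left.trans hn
  have hb : b.support ⊆ Finset.range n := Finset.subset_union_right.trans hn
  rw [Finsupp.sum_of_support_subset a ha _ (by simp),
    Finsupp.sum_of_support_subset b hb _ (by simp)]
  filter_upwards [Lp.coeFn_add
      (∑ l ∈ Finset.range n, a l • (hx (k + (l + 1 : ℕ))).toLp (x (k + (l + 1 : ℕ))))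
      (∑ l ∈ Finset.range n, b l • (hy (k + (l + 1 : ℕ))).toLp (y (k + (l + 1 : ℕ)))),
    coeFn_sum_smul (Finset.range n) a (fun l => x (k + (l + 1 : ℕ))) fun l => hx _,
    coeFn_sum_smul (Finset.range n) b (fun l => y (k + (l + 1 : ℕ))) fun l => hy _] with ω h1 h2 h3
  rw [h1, Pi.add_apply, ← h2, ← h3, ← Finset.sum_add_distrib, Finset.range_eq_Ico]
  exact (Finset.sum_Ico_add' (fun l : ℕ => a (l - 1) * x (k + l) ω + b (l - 1) * y (k + l) ω)
    0 n 1).symm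

end WhiteNoise

/-! ### Backward determinism -/

theorem theorem3 {Ω : Type*} [MeasurableSpace Ω] (μ : Measure Ω) [IsProbabilityMeasure μ]
    (w : ℤ → Ω → ℂ) (hw : IsWhiteNoise μ w)
    (g h : HardyTwo)
    (hg : IsCyclicVector backwardShift g)
    (hh0 : h ≠ 0) (hh : ¬ IsCyclicVector backwardShift h)
    (x y : ℤ → Ω → ℂ)
    (hx : IsCausalFilterOutput μ w (fun l => g l) x)
    (hy : IsCausalFilterOutput μ w (fun l => h l) y) :
    IsBackwardDeterministic μ x y := by
  intro k
  set e := lpStandardBasis ℤ with he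
  set Z : Submodule ℂ (Lp ℂ 2 μ) := (Submodule.span ℂ
    (Set.range (fun l : ℕ => (hx (k + (l + 1 : ℕ))).1.toLp (x (k + (l + 1 : ℕ)))) ∪
      Set.range fun l : ℕ =>
        (hy (k + (l + 1 : ℕ))).1.toLp (y (k + (l + 1 : ℕ))))).topologicalClosure with hZ
  have key : ∀ v ∈ ({causalEmbedding e g, causalEmbedding e h} : Set _),
      hw.isometry (bilateralShift e (-k) v) ∈ Z := by
    intro v hv
    have hvM := causalEmbedding_mem_closure_span e hg hh0 hh v hv
    -- Pull the closed span of future values back along the isometry; only the generators need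
    -- checking.
    suffices hle : (Submodule.span ℂ {z | ∃ v ∈ ({causalEmbedding e g, causalEmbedding e h} : Set _),
        ∃ n : ℤ, 0 < n ∧ bilateralShift e (-n) v = z}).topologicalClosure ≤
        Z.comap (hw.isometry.comp (bilateralShift e (-k))).toLinearMap from hle hvM
    refine Submodule.topologicalClosure_minimal _ (Submodule.span_le.2 ?_)
      ((Submodule.isClosed_topologicalClosure _).preimage
        (hw.isometry.comp (bilateralShift e (-k))).continuous)
    rintro _ ⟨v, hv, n, hn, rfl⟩
    obtain ⟨l, rfl⟩ : ∃ l : ℕ, n = ((l + 1 : ℕ) : ℤ) := ⟨(n - 1).toNat, by lia⟩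
    show hw.isometry (bilateralShift e (-k) (bilateralShift e _ v)) ∈ Z
    rw [bilateralShift_bilateralShift, ← neg_add]
    refine Submodule.le_topologicalClosure _ (Submodule.subset_span ?_)
    rcases hv with rfl | rfl
    · exact Or.inl ⟨l, (hx.isometry_eq hw _).symm⟩
    · exact Or.inr ⟨l, (hy.isometry_eq hw _).symm⟩
  have hgZ := key _ (Set.mem_insert _ _)
  have hhZ := key _ (Set.mem_insert_of_mem _ rfl)
  rw [hx.isometry_eq hw k] at hgZ
  rw [hy.isometry_eq hw k] at hhZ
  exact ⟨isEstimableFromFuture_of_mem_closure_span (fun k => (hx k).1) (fun k => (hy k).1) _ hgZ,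
    isEstimableFromFuture_of_mem_closure_span (fun k => (hx k).1) (fun k => (hy k).1) _ hhZ⟩
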